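/- Let $k\ge 1$ and $j,r\ge 0$ be integers with $j+r\le k$, and let $q$ be a complex number with $|q|<1$. Write $(a;q)_n=\prod_{i=0}^{n-1}(1-aq^i)$, $(a;q)_\infty=\prod_{i\ge 0}(1-aq^i)$, $(q)_n=(q;q)_n$, and $(a,b,c;q)_\infty=(a;q)_\infty(b;q)_\infty(c;q)_\infty$. Then the following sum over all integers $s_1\ge s_2\ge\cdots\ge s_k\ge 0$ converges absolutely, and $$ \sum_{s_1\ge s_2\ge\cdots\ge s_k\ge 0} \frac{q^{s_1^2+\cdots+s_k^2-(s_1+\cdots+s_j)+(s_{k-r+1}+\cdots+s_k)}} {(q)_{s_1-s_2}(q)_{s_2-s_3}\cdots(q)_{s_{k-1}-s_k}\,(q^2;q^2)_{s_k}} =\sum_{s=0}^{j}\frac{(q^{k+1-r+j-2s},\,q^{k+1+r-j+2s},\,q^{2k+2};\,q^{2k+2})_\infty}{(q;q)_\infty}. $$ -/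

import Mathlib

noncomputable section

/-- The finite `q`-shifted factorial `(a; q)_n = ∏_{i=0}^{n-1} (1 - a q^i)`. -/
def qPoch (a q : ℂ) (n : ℕ) : ℂ := ∏ i ∈ Finset.range n, (1 - a * q ^ i)

/-- The infinite `q`-shifted factorial `(a; q)_∞ = ∏_{i ≥ 0} (1 - a q^i)`, for `‖q‖ < 1`. -/
def qPochInf (a q : ℂ) : ℂ := ∏' i : ℕ, (1 - a * q ^ i)

/-- The infinite product defining `(a; q)_∞` converges when `‖q‖ < 1`. -/
theorem multipliable_qPochInf (a q : ℂ) (hq : ‖q‖ < 1) :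
    Multipliable fun i : ℕ => 1 - a * q ^ i := by
  have h : Summable fun i : ℕ => ‖-(a * q ^ i)‖ := by
    simp only [norm_neg, norm_mul, norm_pow]
    exact (summable_geometric_of_lt_one (norm_nonneg q) hq).mul_left _
  simpa only [sub_eq_add_neg] using multipliable_one_add_of_summable h

/-- `(a, b, c; q)_∞ = (a; q)_∞ (b; q)_∞ (c; q)_∞`. -/
def qPochInf₃ (a b c q : ℂ) : ℂ := qPochInf a q * qPochInf b q * qPochInf c q

/-- The index set of the multisum: sequences `s₁ ≥ s₂ ≥ ⋯ ≥ s_k ≥ 0` of integers. -/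
def Chain (k : ℕ) : Type := {s : Fin k → ℕ // Antitone s}

/-- The entry `s_i` for `1 ≤ i ≤ k` (indexed from `1`; the value `0` outside this range
is never used). -/
def Chain.part {k : ℕ} (s : Chain k) (i : ℕ) : ℕ :=
  if h : 1 ≤ i ∧ i ≤ k then s.1 ⟨i - 1, by omega⟩ else 0

/-- The exponent `s₁² + ⋯ + s_k² - (s₁ + ⋯ + s_j) + (s_{k-r+1} + ⋯ + s_k)`. -/
def Chain.exponent {k : ℕ} (s : Chain k) (j r : ℕ) : ℤ :=
  (∑ i ∈ Finset.Icc 1 k, (s.part i : ℤ) ^ 2) - (∑ i ∈ Finset.Icc 1 j, (s.part i : ℤ))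
    + ∑ i ∈ Finset.Icc (k - r + 1) k, (s.part i : ℤ)

/-- The denominator `(q)_{s₁-s₂} ⋯ (q)_{s_{k-1}-s_k} (q²; q²)_{s_k}`. -/
def Chain.denom {k : ℕ} (s : Chain k) (q : ℂ) : ℂ :=
  (∏ i ∈ Finset.Icc 1 (k - 1), qPoch q q (s.part i - s.part (i + 1)))
    * qPoch (q ^ 2) (q ^ 2) (s.part k)

end

noncomputable section

open Filter Topology

/-! The proof is a Bailey chain with bilateral coefficients. Represent a sequence as `∑_{m ∈ ℤ} a_m
/ ((q)_{n-m} (q)_{n+m+c})`. For `c ∈ {-1, 0, 1}`, summing it against `q^(s²+cs) / (q)_{N-s}`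
multiplies `a_m` by `q^(m²+cm)` (`bailey_step`). The seed `1 / (q²; q²)_n` has `c = 0`, `a_m =
(-1)^m q^(m²)`. With the extra factor `1 / (q)_{N-s₁}`, the multisum is `k` such steps from `s_k`
outward: `r` of weight 1, `k-j-r` of weight 0, `j` of weight -1.

Passing between `c = 0` and `c = 1` is free, by a reflection symmetry of `a` (`tsum_shift_right`). A
weight -1 step on `c = 0` splits: `1/(q)_{n+m} = 1/(q)_{n+m-1} + q^(n+m)/(q)_{n+m}` yields a piece
with `c = -1` and one with `c = 0`, so `j` steps produce `j + 1` theta series. As `N → ∞` both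
reciprocals tend to `1/(q)_∞`; one cancels the limit of `1/(q)_{N-s₁}`, and the Jacobi triple
product evaluates each series. The case `q = 0` is separate because integer powers are manipulated
with `q` invertible. -/

/-- The reciprocal `1 / (q; q)_n`, extended by `0` to negative integers `n`. -/
def invPoch (q : ℂ) (n : ℤ) : ℂ := if n < 0 then 0 else (qPoch q q n.toNat)⁻¹

/-! ### Reciprocal q-factorials. -/

theorem one_sub_pow_succ_ne_zero {q : ℂ} (hq : ‖q‖ < 1) (n : ℕ) : 1 - q ^ (n + 1) ≠ 0 := by
  intro h
  have h1 : ‖q ^ (n + 1)‖ < 1 := by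
    rw [norm_pow]
    exact pow_lt_one₀ (norm_nonneg q) hq (Nat.succ_ne_zero n)
  rw [← sub_eq_zero.mp h] at h1
  simp at h1

theorem qPoch_succ (a q : ℂ) (n : ℕ) : qPoch a q (n + 1) = qPoch a q n * (1 - a * q ^ n) :=
  Finset.prod_range_succ _ _

theorem invPoch_of_neg (q : ℂ) {n : ℤ} (hn : n < 0) : invPoch q n = 0 := if_pos hn

theorem invPoch_natCast (q : ℂ) (n : ℕ) : invPoch q n = (qPoch q q n)⁻¹ := by
  simp [invPoch]

theorem invPoch_zero (q : ℂ) : invPoch q 0 = 1 := by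
  simp [invPoch, qPoch]

theorem invPoch_sub_one {q : ℂ} (hq : ‖q‖ < 1) (n : ℤ) :
    invPoch q (n - 1) = (1 - q ^ n) * invPoch q n := by
  rcases lt_trichotomy n 0 with h | h | h
  · rw [invPoch_of_neg q h, invPoch_of_neg q (by omega), mul_zero]
  · subst h
    rw [invPoch_of_neg q (by omega)]
    simp
  · obtain ⟨m, rfl⟩ : ∃ m : ℕ, n = (m + 1 : ℕ) := ⟨(n - 1).toNat, by omega⟩
    rw [invPoch_natCast, show ((m + 1 : ℕ) : ℤ) - 1 = (m : ℕ) by push_cast; ring,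
      invPoch_natCast, zpow_natCast, qPoch_succ, ← pow_succ', mul_inv]
    have := one_sub_pow_succ_ne_zero hq m
    field_simp

/-! ### q-Chu–Vandermonde and the Bailey lemma. -/

theorem sum_invPoch_mul_invPoch {q : ℂ} (hq : ‖q‖ < 1) (M L : ℕ) :
    ∑ t ∈ Finset.range (M + 1), q ^ (t ^ 2 + L * t) *
      (invPoch q ((M : ℤ) - t) * (invPoch q t * invPoch q ((t : ℤ) + L)))
      = invPoch q M * invPoch q ((M : ℤ) + L) := by
  induction M generalizing L with
  | zero => simp [invPoch_zero]
  | succ M ih =>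
    have hM := one_sub_pow_succ_ne_zero hq M
    have ih' := ih (L + 1)
    refine mul_left_cancel₀ hM ?_
    have e1 : (1 - q ^ (M + 1)) * (invPoch q ((M + 1 : ℕ) : ℤ) *
        invPoch q (((M + 1 : ℕ) : ℤ) + L)) = invPoch q M * invPoch q ((M : ℤ) + (L + 1 : ℕ)) := by
      have := invPoch_sub_one hq ((M + 1 : ℕ) : ℤ)
      rw [zpow_natCast] at this
      rw [← mul_assoc, ← this]
      congr 2 <;> push_cast <;> ring
    rw [e1, ← ih', Finset.mul_sum]
    -- Split `1 - q^(M+1) = (1 - q^t) + q^t (1 - q^(M+1-t))`. After `t ↦ t + 1` in the first part,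
    -- the two recombine into the sum for `(M, L + 1)`.
    have key : ∀ t : ℕ, t ∈ Finset.range (M + 1 + 1) → (1 - q ^ (M + 1)) * (q ^ (t ^ 2 + L * t) *
        (invPoch q (((M + 1 : ℕ) : ℤ) - t) * (invPoch q t * invPoch q ((t : ℤ) + L))))
        = q ^ (t ^ 2 + L * t) * (invPoch q (((M + 1 : ℕ) : ℤ) - t) *
            (invPoch q ((t : ℤ) - 1) * invPoch q ((t : ℤ) + L)))
          + q ^ (t ^ 2 + L * t + t) * (invPoch q ((M : ℤ) - t) *
            (invPoch q t * invPoch q ((t : ℤ) + L))) := by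
      intro t ht
      have ht : t ≤ M + 1 := by simpa [Nat.lt_succ_iff] using ht
      obtain ⟨d, hd⟩ := Nat.exists_eq_add_of_le ht
      have h1 := invPoch_sub_one hq (t : ℤ)
      have h2 := invPoch_sub_one hq (((M + 1 : ℕ) : ℤ) - t)
      rw [show ((M + 1 : ℕ) : ℤ) - t - 1 = (M : ℤ) - t by push_cast; ring] at h2
      rw [h1, h2, hd, show ((t + d : ℕ) : ℤ) - t = (d : ℕ) by push_cast; ring, zpow_natCast,
        zpow_natCast, pow_add, pow_add]
      ring
    rw [Finset.sum_congr rfl key, Finset.sum_add_distrib, Finset.sum_range_succ']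
    nth_rw 2 [Finset.sum_range_succ]
    have z1 : invPoch q (((0 : ℕ) : ℤ) - 1) = 0 := invPoch_of_neg q (by norm_num)
    have z2 : invPoch q ((M : ℤ) - (M + 1 : ℕ)) = 0 := invPoch_of_neg q (by push_cast; omega)
    simp only [z1, z2, zero_mul, mul_zero, add_zero]
    rw [← Finset.sum_add_distrib]
    refine Finset.sum_congr rfl fun t _ => ?_
    have h3 := invPoch_sub_one hq ((t : ℤ) + (L + 1 : ℕ))
    rw [show (t : ℤ) + (L + 1 : ℕ) - 1 = t + L by push_cast; ring,
      show (t : ℤ) + (L + 1 : ℕ) = ((t + L + 1 : ℕ) : ℤ) by push_cast; ring, zpow_natCast] at h3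
    rw [h3, show ((M + 1 : ℕ) : ℤ) - (t + 1 : ℕ) = (M : ℤ) - t by push_cast; ring,
      show ((t + 1 : ℕ) : ℤ) - 1 = t by push_cast; ring,
      show ((t + 1 : ℕ) : ℤ) + L = ((t + L + 1 : ℕ) : ℤ) by push_cast; ring,
      show (t : ℤ) + (L + 1 : ℕ) = ((t + L + 1 : ℕ) : ℤ) by push_cast; ring]
    ring

theorem bailey_step_of_nonneg {q : ℂ} (hq : ‖q‖ < 1) (hq0 : q ≠ 0) (N : ℕ) (m : ℕ) (c : ℤ)
    (h : 0 ≤ 2 * m + c) :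
    ∑ s ∈ Finset.range (N + 1), invPoch q ((N : ℤ) - s) * q ^ ((s : ℤ) ^ 2 + c * s) *
      (invPoch q (s - m) * invPoch q (s + m + c))
      = q ^ ((m : ℤ) ^ 2 + c * m) * (invPoch q (N - m) * invPoch q (N + m + c)) := by
  rcases lt_or_ge N m with hN | hN
  · rw [invPoch_of_neg q (by omega : (N : ℤ) - m < 0), zero_mul, mul_zero]
    refine Finset.sum_eq_zero fun s hs => ?_
    have := Finset.mem_range.mp hs
    rw [invPoch_of_neg q (by omega : (s : ℤ) - m < 0), zero_mul, mul_zero]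
  · obtain ⟨M, rfl⟩ := Nat.exists_eq_add_of_le hN
    obtain ⟨L, hL⟩ := Int.eq_ofNat_of_zero_le h
    rw [Finset.range_eq_Ico, ← Finset.sum_Ico_consecutive _ (Nat.zero_le m) (by omega),
      Finset.sum_eq_zero, zero_add, Finset.sum_Ico_eq_sum_range,
      show m + M + 1 - m = M + 1 by omega]
    · have := sum_invPoch_mul_invPoch hq M L
      rw [show ((m + M : ℕ) : ℤ) - m = M by push_cast; ring,
        show ((m + M : ℕ) : ℤ) + m + c = M + L by push_cast; rw [← hL]; ring, ← this,
        Finset.mul_sum]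
      refine Finset.sum_congr rfl fun t _ => ?_
      rw [show ((m + M : ℕ) : ℤ) - (m + t : ℕ) = M - t by push_cast; ring,
        show ((m + t : ℕ) : ℤ) - m = t by push_cast; ring,
        show ((m + t : ℕ) : ℤ) + m + c = t + L by push_cast; rw [← hL]; ring,
        show ((m + t : ℕ) : ℤ) ^ 2 + c * (m + t : ℕ) = ((m : ℤ) ^ 2 + c * m)
          + ((t ^ 2 + L * t : ℕ) : ℤ) by push_cast; rw [← hL]; ring,
        zpow_add₀ hq0, zpow_natCast]
      ring
    · intro s hs
      have := (Finset.mem_Ico.mp hs).2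
      rw [invPoch_of_neg q (by omega : (s : ℤ) - m < 0), zero_mul, mul_zero]

/-- The substitution `m ↦ -m - c` swaps the two reciprocals and preserves `m² + cm`, so one may
assume `2m + c ≥ 0`; then `c ≤ 1` forces `m ≥ 0`. -/
theorem bailey_step {q : ℂ} (hq : ‖q‖ < 1) (hq0 : q ≠ 0) (N : ℕ) (m c : ℤ) (hc : -1 ≤ c)
    (hc' : c ≤ 1) :
    ∑ s ∈ Finset.range (N + 1), invPoch q ((N : ℤ) - s) * q ^ ((s : ℤ) ^ 2 + c * s) *
      (invPoch q (s - m) * invPoch q (s + m + c))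
      = q ^ (m ^ 2 + c * m) * (invPoch q (N - m) * invPoch q (N + m + c)) := by
  rcases le_or_gt 0 (2 * m + c) with h | h
  · obtain ⟨a, rfl⟩ := Int.eq_ofNat_of_zero_le (by omega : 0 ≤ m)
    exact bailey_step_of_nonneg hq hq0 N a c h
  · obtain ⟨a, ha⟩ := Int.eq_ofNat_of_zero_le (by omega : 0 ≤ -m - c)
    obtain rfl : m = -a - c := by omega
    have := bailey_step_of_nonneg hq hq0 N a c (by omega)
    rw [show (-(a : ℤ) - c) ^ 2 + c * (-a - c) = (a : ℤ) ^ 2 + c * a by ring,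
      show (N : ℤ) - (-a - c) = N + a + c by ring, show (N : ℤ) + (-a - c) + c = N - a by ring,
      mul_comm (invPoch q _), ← this]
    refine Finset.sum_congr rfl fun s _ => ?_
    rw [show (s : ℤ) - (-a - c) = s + a + c by ring, show (s : ℤ) + (-a - c) + c = s - a by ring,
      mul_comm (invPoch q (s + a + c))]

/-! ### Bilateral sums and the seed pair. -/

/-- The reciprocals vanish unless `-y ≤ m ≤ x`, so `a` needs no decay. -/
theorem summable_mul_invPoch_mul_invPoch (q : ℂ) (a : ℤ → ℂ) (x y : ℤ) :
    Summable fun m : ℤ => a m * (invPoch q (x - m) * invPoch q (y + m)) := by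
  refine summable_of_ne_finset_zero (s := Finset.Icc (-y) x) fun m hm => ?_
  rw [Finset.mem_Icc, not_and_or, not_le, not_le] at hm
  rcases hm with h | h
  · rw [invPoch_of_neg q (by omega : y + m < 0), mul_zero, mul_zero]
  · rw [invPoch_of_neg q (by omega : x - m < 0), zero_mul, mul_zero]

theorem tsum_eq_zero_of_reflect (f : ℤ → ℂ) (c : ℤ) (h : ∀ m, f (c - m) = -f m) :
    ∑' m, f m = 0 := by
  have h1 := (Equiv.subLeft c).tsum_eq f
  simp only [Equiv.subLeft_apply, h, tsum_neg] at h1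
  exact self_eq_neg.mp h1.symm

/-- Changing the parameter of a bilateral Bailey pair. -/
theorem tsum_shift_right {q : ℂ} (hq : ‖q‖ < 1) (hq0 : q ≠ 0) (a : ℤ → ℂ)
    (ha : ∀ m, a (-1 - m) = -(q ^ (2 * m + 1) * a m)) (n : ℤ) :
    ∑' m, a m * (invPoch q (n - m) * invPoch q (n + m))
      = ∑' m, a m * (invPoch q (n - m) * invPoch q (n + 1 + m)) := by
  -- This is the difference of the two sides; its summand is odd under `m ↦ -1 - m`.
  have h0 : ∑' m, q ^ (n + 1 + m) * a m * (invPoch q (n - m) * invPoch q (n + 1 + m)) = 0 := by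
    refine tsum_eq_zero_of_reflect _ (-1) fun m => ?_
    rw [ha, show n - (-1 - m) = n + 1 + m by ring, show n + 1 + (-1 - m) = n - m by ring,
      show q ^ (n + 1 + m) = q ^ (n - m) * q ^ (2 * m + 1) by rw [← zpow_add₀ hq0]; ring_nf]
    ring
  rw [← sub_zero (∑' m, a m * (invPoch q (n - m) * invPoch q (n + 1 + m))), ← h0,
    ← (summable_mul_invPoch_mul_invPoch q a n (n + 1)).tsum_sub
      (summable_mul_invPoch_mul_invPoch q (fun m => q ^ (n + 1 + m) * a m) n (n + 1))]
  refine tsum_congr fun m => ?_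
  have := invPoch_sub_one hq (n + 1 + m)
  rw [show n + 1 + m - 1 = n + m by ring] at this
  rw [this]
  ring

theorem neg_one_zpow_sub (c m : ℤ) : (-1 : ℂ) ^ (c - m) = (-1) ^ c * (-1) ^ m := by
  rw [zpow_sub₀ (by norm_num), div_eq_mul_inv, ← inv_zpow, inv_neg_one]

theorem tsum_neg_one_zpow_mul_zpow_sq {q : ℂ} (hq : ‖q‖ < 1) (hq0 : q ≠ 0) (n : ℕ) :
    ∑' m : ℤ, (-1) ^ m * q ^ (m ^ 2) * (invPoch q (n - m) * invPoch q (n + m))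
      = (qPoch (q ^ 2) (q ^ 2) n)⁻¹ := by
  induction n with
  | zero =>
    rw [tsum_eq_single 0]
    · simp [invPoch_zero, qPoch]
    · intro m hm
      rcases lt_or_gt_of_ne hm with h | h
      · rw [invPoch_of_neg q (by omega : ((0 : ℕ) : ℤ) + m < 0), mul_zero, mul_zero]
      · rw [invPoch_of_neg q (by omega : ((0 : ℕ) : ℤ) - m < 0), zero_mul, mul_zero]
  | succ n ih =>
    have hq2 : ‖q ^ 2‖ < 1 := by
      rw [norm_pow]; exact pow_lt_one₀ (norm_nonneg q) hq two_ne_zero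
    have hn := one_sub_pow_succ_ne_zero hq2 n
    -- A null sum, odd under `m ↦ 1 - m`. With `x = q^(n+1-m)`, `y = q^(n+1+m)`, adding it gives `(1
    -- - x) + x(1 - y) = 1 - xy`, the new factor `1 - q^(2n+2)`.
    have h0 : ∑' m : ℤ, (-1) ^ m * q ^ (m ^ 2) * q ^ ((n : ℤ) + 1 - m) *
        (invPoch q (n + 1 - m) * invPoch q (n + m)) = 0 := by
      refine tsum_eq_zero_of_reflect _ 1 fun m => ?_
      rw [neg_one_zpow_sub, show (n : ℤ) + 1 - (1 - m) = n + m by ring,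
        show (n : ℤ) + (1 - m) = n + 1 - m by ring, mul_assoc _ (q ^ _) (q ^ _),
        mul_assoc _ (q ^ _) (q ^ _), ← zpow_add₀ hq0, ← zpow_add₀ hq0,
        show (1 - m) ^ 2 + ((n : ℤ) + m) = m ^ 2 + (n + 1 - m) by ring]
      ring
    rw [tsum_shift_right hq hq0, ← add_zero (∑' m : ℤ, _), ← h0,
      ← (summable_mul_invPoch_mul_invPoch q _ _ _).tsum_add
        (summable_mul_invPoch_mul_invPoch q _ _ _)] at ih
    · rw [qPoch_succ, mul_inv, ← ih, eq_mul_inv_iff_mul_eq₀ (by rwa [← pow_succ']), mul_comm,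
        ← tsum_mul_left]
      refine tsum_congr fun m => ?_
      have h1 := invPoch_sub_one hq ((n : ℤ) + 1 - m)
      have h2 := invPoch_sub_one hq ((n : ℤ) + 1 + m)
      rw [show (n : ℤ) + 1 - m - 1 = n - m by ring] at h1
      rw [show (n : ℤ) + 1 + m - 1 = n + m by ring] at h2
      have h3 : q ^ 2 * (q ^ 2) ^ n = q ^ ((n : ℤ) + 1 - m) * q ^ ((n : ℤ) + 1 + m) := by
        rw [← zpow_add₀ hq0, ← pow_succ', ← pow_mul, ← zpow_natCast]
        congr 1
        push_cast
        ring
      push_cast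
      rw [h1, h2, h3]
      ring
    · intro m
      rw [neg_one_zpow_sub, show (-1 - m) ^ 2 = (2 * m + 1) + m ^ 2 by ring, zpow_add₀ hq0]
      simp
      ring

/-! ### The Jacobi triple product. -/

set_option maxHeartbeats 400000 in
/-- A finite form of the Jacobi triple product identity. -/
theorem finite_jacobi_triple_product {w z : ℂ} (hw : ‖w‖ < 1) (hw0 : w ≠ 0) (hz : z ≠ 0) (n : ℕ) :
    ∑' m : ℤ, (-1) ^ m * w ^ (m ^ 2) * z ^ m * (invPoch (w ^ 2) (n - m) * invPoch (w ^ 2) (n + m))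
      = qPoch (w * z) (w ^ 2) n * qPoch (w / z) (w ^ 2) n * invPoch (w ^ 2) (2 * n) := by
  have hp : ‖w ^ 2‖ < 1 := by
    rw [norm_pow]; exact pow_lt_one₀ (norm_nonneg w) hw two_ne_zero
  have hp0 : w ^ 2 ≠ 0 := pow_ne_zero 2 hw0
  induction n with
  | zero =>
    rw [tsum_eq_single 0]
    · simp [invPoch_zero, qPoch]
    · intro m hm
      rcases lt_or_gt_of_ne hm with h | h
      · rw [invPoch_of_neg _ (by omega : ((0 : ℕ) : ℤ) + m < 0), mul_zero, mul_zero]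
      · rw [invPoch_of_neg _ (by omega : ((0 : ℕ) : ℤ) - m < 0), zero_mul, mul_zero]
  | succ n ih =>
    set p := w ^ 2 with hpdef
    set a : ℤ → ℂ := fun m => (-1) ^ m * w ^ (m ^ 2) * z ^ m with ha
    have ha1 (m : ℤ) : a (m - 1) * (w * z) = - (a m * p * (p ^ m)⁻¹) := by
      have e : w ^ ((m - 1) ^ 2) * w = w ^ (m ^ 2) * p * (p ^ m)⁻¹ := by
        rw [hpdef, ← zpow_natCast w 2, ← zpow_mul, ← zpow_neg, ← zpow_add₀ hw0, ← zpow_add₀ hw0,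
          ← zpow_add_one₀ hw0]
        congr 1
        push_cast
        ring
      simp only [ha]
      rw [zpow_sub_one₀ hz, zpow_sub_one₀ (by norm_num : (-1 : ℂ) ≠ 0), inv_neg_one]
      field_simp at e ⊢
      linear_combination -e
    have ha2 (m : ℤ) : a (m + 1) * (w / z) = - (a m * p * p ^ m) := by
      have e : w ^ ((m + 1) ^ 2) * w = w ^ (m ^ 2) * p * p ^ m := by
        rw [hpdef, ← zpow_natCast w 2, ← zpow_mul, ← zpow_add₀ hw0, ← zpow_add₀ hw0,
          ← zpow_add_one₀ hw0]
        congr 1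
        push_cast
        ring
      simp only [ha]
      rw [zpow_add_one₀ hz, zpow_add_one₀ (by norm_num : (-1 : ℂ) ≠ 0)]
      field_simp
      linear_combination -e
    clear_value a p
    -- In the expansion of `(1 - wz pⁿ)(1 - (w/z) pⁿ)`, shifting `m` lets `ha1` and `ha2` absorb
    -- `wz` and `w/z`; the induction step then holds term by term.
    have s1 : ∑' m, a (m - 1) * (invPoch p (n + 1 - m) * invPoch p (n - 1 + m))
        = ∑' m, a m * (invPoch p (n - m) * invPoch p (n + m)) := by
      rw [← (Equiv.subRight (1 : ℤ)).tsum_eq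
        fun m => a m * (invPoch p (n - m) * invPoch p (n + m))]
      refine tsum_congr fun m => ?_
      simp only [Equiv.subRight_apply]
      ring_nf
    have s2 : ∑' m, a (m + 1) * (invPoch p (n - 1 - m) * invPoch p (n + 1 + m))
        = ∑' m, a m * (invPoch p (n - m) * invPoch p (n + m)) := by
      rw [← (Equiv.addRight (1 : ℤ)).tsum_eq
        fun m => a m * (invPoch p (n - m) * invPoch p (n + m))]
      refine tsum_congr fun m => ?_
      simp only [Equiv.coe_addRight]
      ring_nf
    have n1 := one_sub_pow_succ_ne_zero hp (2 * n)
    have n2 := one_sub_pow_succ_ne_zero hp (2 * n + 1)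
    have u2 : invPoch p (2 * n) = (1 - p ^ (2 * n + 1)) * (1 - p ^ (2 * n + 1 + 1)) *
        invPoch p (2 * (n + 1 : ℕ)) := by
      have e1 := invPoch_sub_one hp ((2 * n + 1 : ℕ) : ℤ)
      have e2 := invPoch_sub_one hp ((2 * n + 1 + 1 : ℕ) : ℤ)
      rw [zpow_natCast] at e1 e2
      rw [show ((2 * n + 1 : ℕ) : ℤ) - 1 = 2 * n by push_cast; ring] at e1
      rw [show ((2 * n + 1 + 1 : ℕ) : ℤ) - 1 = (2 * n + 1 : ℕ) by push_cast; ring,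
        show ((2 * n + 1 + 1 : ℕ) : ℤ) = 2 * (n + 1 : ℕ) by push_cast; ring] at e2
      rw [e1, e2, mul_assoc]
    have main : (1 - p ^ (2 * n + 1)) * (1 - p ^ (2 * n + 1 + 1)) *
        ∑' m, a m * (invPoch p ((n + 1 : ℕ) - m) * invPoch p ((n + 1 : ℕ) + m))
        = (1 - w * z * p ^ n) * (1 - w / z * p ^ n) *
        ∑' m, a m * (invPoch p (n - m) * invPoch p (n + m)) := by
      have hexp : (1 - w * z * p ^ n) * (1 - w / z * p ^ n) = (1 + p ^ (2 * n + 1))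
          - w * z * p ^ n - w / z * p ^ n := by
        have : w * z * (w / z) = p := by field_simp; rw [hpdef]
        linear_combination (p ^ n) ^ 2 * this
      have split (T S₁ S₂ : ℂ) (h₁ : S₁ = T) (h₂ : S₂ = T) :
          (1 + p ^ (2 * n + 1) - w * z * p ^ n - w / z * p ^ n) * T
          = (1 + p ^ (2 * n + 1)) * T - w * z * p ^ n * S₁ - w / z * p ^ n * S₂ := by
        rw [h₁, h₂]; ring
      have t0 := (summable_mul_invPoch_mul_invPoch p a n n).mul_left (1 + p ^ (2 * n + 1))
      have t1 := (summable_mul_invPoch_mul_invPoch p (fun m => a (m - 1)) (n + 1)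
        (n - 1)).mul_left (w * z * p ^ n)
      have t2 := (summable_mul_invPoch_mul_invPoch p (fun m => a (m + 1)) (n - 1)
        (n + 1)).mul_left (w / z * p ^ n)
      rw [hexp, split _ _ _ s1 s2]
      rw [← tsum_mul_left, ← tsum_mul_left, ← tsum_mul_left, ← tsum_mul_left,
        ← Summable.tsum_sub, ← Summable.tsum_sub]
      · refine tsum_congr fun m => ?_
        have h1 := invPoch_sub_one hp ((n : ℤ) + 1 - m)
        have h2 := invPoch_sub_one hp ((n : ℤ) + 1 + m)
        have h3 := invPoch_sub_one hp ((n : ℤ) - m)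
        have h4 := invPoch_sub_one hp ((n : ℤ) + m)
        rw [show (n : ℤ) + 1 - m - 1 = n - m by ring] at h1
        rw [show (n : ℤ) + 1 + m - 1 = n + m by ring] at h2
        rw [show (n : ℤ) - m - 1 = n - 1 - m by ring] at h3
        rw [show (n : ℤ) + m - 1 = n - 1 + m by ring] at h4
        have k1 := ha1 m
        have k2 := ha2 m
        have hpm : p ^ m ≠ 0 := zpow_ne_zero m hp0
        rw [show (n : ℤ) + 1 - m = n - m + 1 by ring, zpow_add_one₀ hp0, zpow_sub₀ hp0,
          zpow_natCast] at h1
        rw [show (n : ℤ) + 1 + m = n + m + 1 by ring, zpow_add_one₀ hp0, zpow_add₀ hp0,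
          zpow_natCast] at h2
        rw [zpow_sub₀ hp0, zpow_natCast, h1] at h3
        rw [zpow_add₀ hp0, zpow_natCast, h2] at h4
        have g1 : w * z * p ^ n * (a (m - 1) * (invPoch p (n + 1 - m) * invPoch p (n - 1 + m)))
          = - (a m * p * (p ^ m)⁻¹) * p ^ n * (invPoch p (n + 1 - m) * invPoch p (n - 1 + m)) := by
          rw [← k1]; ring
        have g2 : w / z * p ^ n * (a (m + 1) * (invPoch p (n - 1 - m) * invPoch p (n + 1 + m)))
          = - (a m * p * p ^ m) * p ^ n * (invPoch p (n - 1 - m) * invPoch p (n + 1 + m)) := by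
          rw [← k2]; ring
        rw [g1, g2]
        push_cast
        rw [h3, h4, h1, h2, show (n : ℤ) + 1 - m = n - m + 1 by ring,
          show (n : ℤ) + 1 + m = n + m + 1 by ring]
        generalize invPoch p (n - m + 1) = X
        generalize invPoch p (n + m + 1) = Y
        generalize a m = α
        generalize p ^ m = P at hpm ⊢
        field_simp
        ring
      · exact t0.sub t1
      · exact t2
      · exact t0
      · exact t1
    simp only [ha] at main
    rw [ih, u2] at main
    rw [qPoch_succ, qPoch_succ]
    refine mul_left_cancel₀ (mul_ne_zero n1 n2) ?_
    rw [main]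
    ring

theorem tendsto_qPoch (a : ℂ) {q : ℂ} (hq : ‖q‖ < 1) :
    Tendsto (qPoch a q) atTop (𝓝 (qPochInf a q)) :=
  (multipliable_qPochInf a q hq).tendsto_prod_tprod_nat

theorem qPochInf_self_ne_zero {q : ℂ} (hq : ‖q‖ < 1) : qPochInf q q ≠ 0 := by
  have := tprod_one_add_ne_zero_of_summable (f := fun i : ℕ => -(q * q ^ i)) (fun i => by
    rw [← sub_eq_add_neg, ← pow_succ']
    exact one_sub_pow_succ_ne_zero hq i) (by
    simp only [norm_neg, norm_mul, norm_pow]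
    exact (summable_geometric_of_lt_one (norm_nonneg q) hq).mul_left _)
  simpa only [qPochInf, sub_eq_add_neg] using this

theorem tendsto_invPoch {q : ℂ} (hq : ‖q‖ < 1) :
    Tendsto (invPoch q) atTop (𝓝 (qPochInf q q)⁻¹) := by
  have h : Tendsto (fun n : ℤ => (qPoch q q n.toNat)⁻¹) atTop (𝓝 (qPochInf q q)⁻¹) :=
    ((tendsto_qPoch q hq).comp
      (tendsto_atTop.mpr fun b => (eventually_ge_atTop (b : ℤ)).mono fun n hn => by omega)).inv₀
      (qPochInf_self_ne_zero hq)
  refine h.congr' ((eventually_ge_atTop 0).mono fun n hn => ?_)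
  rw [invPoch, if_neg (not_lt.mpr hn)]

theorem exists_norm_invPoch_le {q : ℂ} (hq : ‖q‖ < 1) : ∃ C, ∀ n, ‖invPoch q n‖ ≤ C := by
  have h : Tendsto (fun n : ℕ => invPoch q n) atTop (𝓝 (qPochInf q q)⁻¹) :=
    (tendsto_invPoch hq).comp tendsto_natCast_atTop_atTop
  obtain ⟨C, hC⟩ := (Metric.isBounded_range_of_tendsto _ h).exists_norm_le
  refine ⟨C, fun n => ?_⟩
  rcases lt_or_ge n 0 with hn | hn
  · rw [invPoch_of_neg q hn, norm_zero]
    exact (norm_nonneg _).trans (hC _ ⟨0, rfl⟩)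
  · obtain ⟨a, rfl⟩ := Int.eq_ofNat_of_zero_le hn
    exact hC _ ⟨a, rfl⟩

/-- Dominated convergence: the reciprocals are uniformly bounded. -/
theorem tendsto_tsum_mul_invPoch {q : ℂ} (hq : ‖q‖ < 1) (a : ℤ → ℂ) (ha : Summable fun m => ‖a m‖)
    (c : ℤ) :
    Tendsto (fun N : ℕ => ∑' m, a m * (invPoch q (N - m) * invPoch q (N + c + m))) atTop
      (𝓝 ((∑' m, a m) * ((qPochInf q q)⁻¹ * (qPochInf q q)⁻¹))) := by
  obtain ⟨C, hC⟩ := exists_norm_invPoch_le hq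
  rw [← tsum_mul_right]
  refine tendsto_tsum_of_dominated_convergence (ha.mul_right (C * C)) (fun m => ?_)
    (Eventually.of_forall fun N m => ?_)
  · refine Tendsto.const_mul _ (Tendsto.mul ?_ ?_)
    · exact (tendsto_invPoch hq).comp
        (tendsto_atTop_add_const_right atTop (-m) tendsto_natCast_atTop_atTop)
    · have := (tendsto_invPoch hq).comp
        (tendsto_atTop_add_const_right atTop (c + m) tendsto_natCast_atTop_atTop)
      simpa only [Function.comp_def, add_assoc] using this
  · rw [norm_mul, norm_mul]
    gcongr
    · exact (norm_nonneg _).trans (hC 0)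
    · exact hC _
    · exact hC _

/-- The Jacobi triple product identity. -/
theorem jacobi_triple_product {w z : ℂ} (hw : ‖w‖ < 1) (hw0 : w ≠ 0) (hz : z ≠ 0)
    (hs : Summable fun m : ℤ => ‖(-1) ^ m * w ^ (m ^ 2) * z ^ m‖) :
    ∑' m : ℤ, (-1) ^ m * w ^ (m ^ 2) * z ^ m = qPochInf₃ (w * z) (w / z) (w ^ 2) (w ^ 2) := by
  have hp : ‖w ^ 2‖ < 1 := by
    rw [norm_pow]; exact pow_lt_one₀ (norm_nonneg w) hw two_ne_zero
  have h1 := tendsto_tsum_mul_invPoch hp _ hs 0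
  have h2 : Tendsto (fun n : ℕ => qPoch (w * z) (w ^ 2) n * qPoch (w / z) (w ^ 2) n *
      invPoch (w ^ 2) (2 * n)) atTop (𝓝 (qPochInf (w * z) (w ^ 2) * qPochInf (w / z) (w ^ 2) *
      (qPochInf (w ^ 2) (w ^ 2))⁻¹)) := by
    refine ((tendsto_qPoch _ hp).mul (tendsto_qPoch _ hp)).mul ((tendsto_invPoch hp).comp ?_)
    exact tendsto_natCast_atTop_atTop.const_mul_atTop' (by norm_num)
  simp only [add_zero, finite_jacobi_triple_product hw hw0 hz] at h1
  have h3 := tendsto_nhds_unique h1 h2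
  have h4 := qPochInf_self_ne_zero hp
  rw [qPochInf₃]
  field_simp at h3
  rw [h3]
  ring

/-! ### Theta series. -/

theorem summable_norm_pow_sq {q : ℂ} (hq : ‖q‖ < 1) : Summable fun m : ℤ => ‖q‖ ^ (m ^ 2) := by
  have h : Summable fun n : ℕ => ‖q‖ ^ (n ^ 2) :=
    (summable_geometric_of_lt_one (norm_nonneg q) hq).of_nonneg_of_le (fun n => by positivity)
      fun n => pow_le_pow_of_le_one (norm_nonneg q) hq.le (Nat.le_self_pow two_ne_zero n)
  refine Summable.of_nat_of_neg ?_ ?_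
  · simpa only [← Nat.cast_pow, zpow_natCast] using h
  · simpa only [neg_sq, ← Nat.cast_pow, zpow_natCast] using h

theorem norm_zpow_le_of_le {q : ℂ} (hq : ‖q‖ < 1) {a b : ℤ} (ha : 0 ≤ a) (hab : a ≤ b) :
    ‖q ^ b‖ ≤ ‖q‖ ^ a := by
  obtain ⟨x, rfl⟩ := Int.eq_ofNat_of_zero_le ha
  obtain ⟨y, rfl⟩ := Int.eq_ofNat_of_zero_le (ha.trans hab)
  rw [norm_zpow]
  simp only [zpow_natCast]
  exact pow_le_pow_of_le_one (norm_nonneg q) hq.le (by exact_mod_cast hab)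

theorem summable_norm_zpow_of_sq_le {q : ℂ} (hq : ‖q‖ < 1) (e : ℤ → ℤ) (he : ∀ m, m ^ 2 ≤ e m) :
    Summable fun m : ℤ => ‖(-1) ^ m * q ^ e m‖ := by
  refine (summable_norm_pow_sq hq).of_nonneg_of_le (fun _ => norm_nonneg _) fun m => ?_
  rw [norm_mul, norm_zpow, norm_neg, norm_one, one_zpow, one_mul]
  exact norm_zpow_le_of_le hq (sq_nonneg m) (he m)

/-- Since `|cm| ≤ k m²`, the exponent is at least `m²`. -/
theorem summable_norm_neg_one_zpow_mul_zpow {q : ℂ} (hq : ‖q‖ < 1) (k : ℕ) (c : ℤ)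
    (hc : |c| ≤ k) :
    Summable fun m : ℤ => ‖(-1) ^ m * q ^ (((k : ℤ) + 1) * m ^ 2 + c * m)‖ := by
  refine summable_norm_zpow_of_sq_le hq _ fun m => ?_
  have h1 : |c * m| ≤ k * m ^ 2 := by
    rw [abs_mul, ← sq_abs m]
    have h2 : |m| ≤ |m| ^ 2 := by
      exact_mod_cast Int.le_self_sq |m|
    exact mul_le_mul hc h2 (abs_nonneg _) (by positivity)
  linarith [neg_abs_le (c * m)]

theorem tsum_neg_one_zpow_mul_zpow {q : ℂ} (hq : ‖q‖ < 1) (hq0 : q ≠ 0) (k : ℕ) (c : ℤ)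
    (hc : |c| ≤ k) :
    ∑' m : ℤ, (-1) ^ m * q ^ (((k : ℤ) + 1) * m ^ 2 + c * m)
      = qPochInf₃ (q ^ ((k : ℤ) + 1 - c)) (q ^ ((k : ℤ) + 1 + c)) (q ^ (2 * k + 2))
          (q ^ (2 * k + 2)) := by
  have hw : ‖q ^ (k + 1)‖ < 1 := by
    rw [norm_pow]; exact pow_lt_one₀ (norm_nonneg q) hq (Nat.succ_ne_zero k)
  have e (m : ℤ) : (-1) ^ m * (q ^ (k + 1)) ^ (m ^ 2) * (q ^ c) ^ m
      = (-1) ^ m * q ^ (((k : ℤ) + 1) * m ^ 2 + c * m) := by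
    rw [← zpow_natCast, ← zpow_mul, ← zpow_mul, mul_assoc, ← zpow_add₀ hq0]
    push_cast
    rfl
  have hs := summable_norm_neg_one_zpow_mul_zpow hq k c hc
  have := jacobi_triple_product hw (pow_ne_zero _ hq0) (zpow_ne_zero c hq0) (by simpa only [e] using hs)
  simp only [e] at this
  rw [this, qPochInf₃, qPochInf₃, mul_comm (qPochInf (q ^ (k + 1) * q ^ c) _)]
  rw [← zpow_natCast q (k + 1), ← zpow_sub₀ hq0, ← zpow_add₀ hq0, zpow_natCast, ← pow_mul]
  congr 3 <;> ring

/-! ### Iterating the Bailey chain. -/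

/-- One step of the Bailey chain with weight `q ^ (s ^ 2 + c * s)`. -/
def baileyStep (q : ℂ) (c : ℤ) (b : ℕ → ℂ) (N : ℕ) : ℂ :=
  ∑ s ∈ Finset.range (N + 1), invPoch q ((N : ℤ) - s) * q ^ ((s : ℤ) ^ 2 + c * s) * b s

/-- The iterated Bailey chain starting at `1 / (q²; q²)_n`, with weights given by `c`. -/
def baileyChain (q : ℂ) (c : ℕ → ℤ) : ℕ → ℕ → ℂ
  | 0, n => (qPoch (q ^ 2) (q ^ 2) n)⁻¹
  | d + 1, N => baileyStep q (c d) (baileyChain q c d) N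

theorem baileyStep_tsum {q : ℂ} (hq : ‖q‖ < 1) (hq0 : q ≠ 0) (a : ℤ → ℂ) (c : ℤ) (hc : -1 ≤ c)
    (hc' : c ≤ 1) (N : ℕ) :
    baileyStep q c (fun n => ∑' m, a m * (invPoch q (n - m) * invPoch q (n + c + m))) N
      = ∑' m, a m * q ^ (m ^ 2 + c * m) * (invPoch q (N - m) * invPoch q (N + c + m)) := by
  simp only [baileyStep, ← tsum_mul_left]
  have hs : ∀ s ∈ Finset.range (N + 1), Summable fun m => invPoch q ((N : ℤ) - s) *
      q ^ ((s : ℤ) ^ 2 + c * s) * (a m * (invPoch q (s - m) * invPoch q (s + c + m))) :=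
    fun s _ => (summable_mul_invPoch_mul_invPoch q a s (s + c)).mul_left _
  rw [← Summable.tsum_finsetSum hs]
  refine tsum_congr fun m => ?_
  have := bailey_step hq hq0 N m c hc hc'
  rw [mul_assoc, add_right_comm, ← this, Finset.mul_sum]
  refine Finset.sum_congr rfl fun s _ => ?_
  rw [add_right_comm]
  ring

/-- In `1/(q)_{s+m} = 1/(q)_{s+m-1} + q^(s+m)/(q)_{s+m}`, the factor `q^s` turns weight -1 into
weight 0 and `q^m` joins the coefficients. -/
theorem baileyStep_neg_one_tsum {q : ℂ} (hq : ‖q‖ < 1) (hq0 : q ≠ 0) (a : ℤ → ℂ) (N : ℕ) :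
    baileyStep q (-1) (fun n => ∑' m, a m * (invPoch q (n - m) * invPoch q (n + 0 + m))) N
      = (∑' m, a m * q ^ (m ^ 2 + -1 * m) * (invPoch q (N - m) * invPoch q (N + -1 + m)))
        + ∑' m, a m * q ^ (m ^ 2 + m) * (invPoch q (N - m) * invPoch q (N + 0 + m)) := by
  have h0 := baileyStep_tsum hq hq0 (fun m => a m * q ^ m) 0 (by norm_num) (by norm_num) N
  have h1 : ∀ m, a m * q ^ (m ^ 2 + m) = a m * q ^ m * q ^ (m ^ 2 + 0 * m) := fun m => by
    rw [mul_assoc, ← zpow_add₀ hq0]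
    congr 2
    ring
  simp only [h1]
  rw [← h0, ← baileyStep_tsum hq hq0 a (-1) (by norm_num) (by norm_num), baileyStep, baileyStep,
    baileyStep, ← Finset.sum_add_distrib]
  refine Finset.sum_congr rfl fun s _ => ?_
  have h2 : ∑' m, a m * (invPoch q (s - m) * invPoch q (s + 0 + m))
      = ∑' m, a m * (invPoch q (s - m) * invPoch q (s + -1 + m)) + q ^ (s : ℤ) *
        ∑' m, a m * q ^ m * (invPoch q (s - m) * invPoch q (s + 0 + m)) := by
    rw [← tsum_mul_left, ← (summable_mul_invPoch_mul_invPoch q a s (s + -1)).tsum_add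
      ((summable_mul_invPoch_mul_invPoch q (fun m => a m * q ^ m) s (s + 0)).mul_left _)]
    refine tsum_congr fun m => ?_
    have := invPoch_sub_one hq (s + m)
    rw [show (s : ℤ) + m - 1 = s + -1 + m by ring] at this
    rw [this, zpow_add₀ hq0, add_zero]
    ring
  have h3 : q ^ ((s : ℤ) ^ 2 + 0 * s) = q ^ ((s : ℤ) ^ 2 + -1 * s) * q ^ (s : ℤ) := by
    rw [← zpow_add₀ hq0]
    congr 1
    ring
  rw [h2, h3]
  ring

/-- The symmetry required by `tsum_shift_right` survives weight 1 steps: `d = 0` serves to enter `c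
= 1`, `d = r` to leave it. -/
theorem reflect_coeff {q : ℂ} (hq0 : q ≠ 0) (d : ℕ) (m : ℤ) :
    (-1) ^ (-1 - m) * q ^ ((-1 - m) ^ 2 + d * ((-1 - m) ^ 2 + (-1 - m)))
      = -(q ^ (2 * m + 1) * ((-1) ^ m * q ^ (m ^ 2 + d * (m ^ 2 + m)))) := by
  rw [neg_one_zpow_sub, show (-1 - m) ^ 2 + d * ((-1 - m) ^ 2 + (-1 - m))
    = (2 * m + 1) + (m ^ 2 + d * (m ^ 2 + m)) by ring, zpow_add₀ hq0]
  simp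
  ring

theorem baileyChain_of_weight_one {q : ℂ} (hq : ‖q‖ < 1) (hq0 : q ≠ 0) (c : ℕ → ℤ) (r : ℕ)
    (hc : ∀ d < r, c d = 1) (d : ℕ) (hd : d ≤ r) (n : ℕ) :
    baileyChain q c d n = ∑' m : ℤ, (-1) ^ m * q ^ (m ^ 2 + d * (m ^ 2 + m)) *
      (invPoch q (n - m) * invPoch q (n + 1 + m)) := by
  induction d generalizing n with
  | zero =>
    rw [baileyChain, ← tsum_neg_one_zpow_mul_zpow_sq hq hq0,
      ← tsum_shift_right hq hq0 _ (reflect_coeff hq0 0)]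
    simp
  | succ d ih =>
    have := baileyStep_tsum hq hq0 (fun m => (-1) ^ m * q ^ (m ^ 2 + d * (m ^ 2 + m))) 1
      (by norm_num) le_rfl n
    rw [baileyChain, funext (ih (by omega)), hc d (by omega), this]
    refine tsum_congr fun m => ?_
    rw [mul_assoc _ (q ^ _) (q ^ _), ← zpow_add₀ hq0]
    congr 3
    push_cast
    ring

theorem baileyChain_of_weight_zero {q : ℂ} (hq : ‖q‖ < 1) (hq0 : q ≠ 0) (c : ℕ → ℤ) (r e : ℕ)
    (hc : ∀ d < r, c d = 1) (hc' : ∀ i < e, c (r + i) = 0) (i : ℕ) (hi : i ≤ e) (n : ℕ) :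
    baileyChain q c (r + i) n = ∑' m : ℤ, (-1) ^ m * q ^ (((i : ℤ) + 1 + r) * m ^ 2 + r * m) *
      (invPoch q (n - m) * invPoch q (n + 0 + m)) := by
  induction i generalizing n with
  | zero =>
    rw [add_zero, baileyChain_of_weight_one hq hq0 c r hc r le_rfl,
      ← tsum_shift_right hq hq0 _ (reflect_coeff hq0 r)]
    refine tsum_congr fun m => ?_
    congr 3
    ring
  | succ i ih =>
    have := baileyStep_tsum hq hq0
      (fun m => (-1) ^ m * q ^ (((i : ℤ) + 1 + r) * m ^ 2 + r * m)) 0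
      (by norm_num) (by norm_num) n
    rw [← add_assoc, baileyChain, funext (ih (by omega)), hc' i (by omega), this]
    refine tsum_congr fun m => ?_
    rw [mul_assoc _ (q ^ _) (q ^ _), ← zpow_add₀ hq0]
    congr 3
    push_cast
    ring

/-- Each step sheds one new `c = -1` term from the `c = 0` part, namely `l = i` when passing from
`i` to `i + 1`; the older ones gain `q^(m²-m)`. -/
theorem baileyChain_of_weight_neg_one {q : ℂ} (hq : ‖q‖ < 1) (hq0 : q ≠ 0) (c : ℕ → ℤ) (t j : ℕ)
    (a : ℤ → ℂ) (h0 : ∀ n, baileyChain q c t n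
      = ∑' m, a m * (invPoch q (n - m) * invPoch q (n + 0 + m)))
    (hc : ∀ i < j, c (t + i) = -1) (i : ℕ) (hi : i ≤ j) (n : ℕ) :
    baileyChain q c (t + i) n
      = (∑' m, a m * (∑ l ∈ Finset.range i, q ^ ((i : ℤ) * m ^ 2 + (2 * l - i) * m)) *
          (invPoch q (n - m) * invPoch q (n + -1 + m)))
        + ∑' m, a m * q ^ ((i : ℤ) * (m ^ 2 + m)) *
          (invPoch q (n - m) * invPoch q (n + 0 + m)) := by
  induction i generalizing n with
  | zero => simp [h0]
  | succ i ih =>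
    have s1 := baileyStep_tsum hq hq0
      (fun m => a m * ∑ l ∈ Finset.range i, q ^ ((i : ℤ) * m ^ 2 + (2 * l - i) * m)) (-1)
      (by norm_num) (by norm_num) n
    have s2 := baileyStep_neg_one_tsum hq hq0 (fun m => a m * q ^ ((i : ℤ) * (m ^ 2 + m))) n
    have hadd (b b' : ℕ → ℂ) : baileyStep q (-1) (fun n => b n + b' n) n
        = baileyStep q (-1) b n + baileyStep q (-1) b' n := by
      simp only [baileyStep, mul_add, Finset.sum_add_distrib]
    rw [← add_assoc, baileyChain, funext (ih (by omega)), hc i (by omega), hadd, s1, s2,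
      ← add_assoc, ← (summable_mul_invPoch_mul_invPoch q _ _ _).tsum_add
        (summable_mul_invPoch_mul_invPoch q _ _ _)]
    congr 1
    · refine tsum_congr fun m => ?_
      rw [Finset.sum_range_succ, ← add_mul, mul_assoc (a m), mul_assoc (a m), ← mul_add,
        ← zpow_add₀ hq0, Finset.sum_mul]
      congr 3
      · refine Finset.sum_congr rfl fun l _ => ?_
        rw [← zpow_add₀ hq0]
        congr 1
        push_cast
        ring
      · congr 1
        push_cast
        ring
    · refine tsum_congr fun m => ?_
      rw [mul_assoc (a m), ← zpow_add₀ hq0]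
      congr 3
      push_cast
      ring

/-- The weights for the Bailey chain attached to the parameters `k, j, r`. -/
def weight (k j r d : ℕ) : ℤ := if d < r then 1 else if k - j ≤ d then -1 else 0

theorem tendsto_baileyChain {q : ℂ} (hq : ‖q‖ < 1) (hq0 : q ≠ 0) (k j r : ℕ) (hjr : j + r ≤ k) :
    Tendsto (baileyChain q (weight k j r) k) atTop
      (𝓝 ((∑ s ∈ Finset.range (j + 1),
        qPochInf₃ (q ^ ((k : ℤ) + 1 - r + j - 2 * s)) (q ^ ((k : ℤ) + 1 + r - j + 2 * s))
            (q ^ (2 * k + 2)) (q ^ (2 * k + 2))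
          / qPochInf q q) * (qPochInf q q)⁻¹)) := by
  obtain ⟨e, rfl⟩ : ∃ e, k = r + e + j := ⟨k - r - j, by omega⟩
  set k := r + e + j with hk
  set a : ℤ → ℂ := fun m => (-1) ^ m * q ^ (((e : ℤ) + 1 + r) * m ^ 2 + r * m) with ha
  have h0 (n : ℕ) := baileyChain_of_weight_zero hq hq0 (weight k j r) r e
    (fun d hd => if_pos hd) (fun i hi => by
      rw [weight, if_neg (by omega), if_neg (by omega)]) e le_rfl n
  have h1 (n : ℕ) := baileyChain_of_weight_neg_one hq hq0 (weight k j r) (r + e) j a h0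
    (fun i hi => by rw [weight, if_neg (by omega), if_pos (by omega)]) j le_rfl n
  have hterm (l : ℤ) (m : ℤ) : a m * q ^ ((j : ℤ) * m ^ 2 + (2 * l - j) * m)
      = (-1) ^ m * q ^ (((k : ℤ) + 1) * m ^ 2 + (r - j + 2 * l) * m) := by
    rw [ha]
    simp only
    rw [mul_assoc, ← zpow_add₀ hq0]
    congr 2
    rw [hk]
    push_cast
    ring
  -- The linear coefficient runs from `r - j` to `r + j`; here `j + r ≤ k` gives convergence.
  have hbound (l : ℕ) (hl : l ≤ j) : |(r : ℤ) - j + 2 * l| ≤ k := by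
    rw [abs_le]
    omega
  have hsum (l : ℕ) (hl : l ≤ j) :
      Summable fun m : ℤ => ‖a m * q ^ ((j : ℤ) * m ^ 2 + (2 * l - j) * m)‖ := by
    simp only [hterm]
    exact summable_norm_neg_one_zpow_mul_zpow hq k _ (hbound l hl)
  have hval (l : ℕ) (hl : l ≤ j) : ∑' m : ℤ, a m * q ^ ((j : ℤ) * m ^ 2 + (2 * l - j) * m)
      = qPochInf₃ (q ^ ((k : ℤ) + 1 - r + j - 2 * l)) (q ^ ((k : ℤ) + 1 + r - j + 2 * l))
            (q ^ (2 * k + 2)) (q ^ (2 * k + 2)) := by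
    simp only [hterm]
    rw [tsum_neg_one_zpow_mul_zpow hq hq0 k _ (hbound l hl)]
    congr 2 <;> ring
  have t1 := tendsto_tsum_mul_invPoch hq
    (fun m => ∑ l ∈ Finset.range j, a m * q ^ ((j : ℤ) * m ^ 2 + (2 * l - j) * m))
    (Summable.of_nonneg_of_le (fun _ => norm_nonneg _) (fun _ => norm_sum_le _ _)
      (summable_sum fun l hl => hsum l (Finset.mem_range.mp hl).le)) (-1)
  have t2 := tendsto_tsum_mul_invPoch hq _ (hsum j le_rfl) 0
  rw [Summable.tsum_finsetSum fun l hl => (hsum l (Finset.mem_range.mp hl).le).of_norm] at t1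
  have t := t1.add t2
  -- The surviving `c = 0` part is the summand `l = j` of the same family.
  rw [← add_mul, ← Finset.sum_range_succ
    (fun l : ℕ => ∑' m : ℤ, a m * q ^ ((j : ℤ) * m ^ 2 + (2 * l - j) * m)),
    Finset.sum_congr rfl fun l hl => hval l (Nat.lt_succ_iff.mp (Finset.mem_range.mp hl))] at t
  rw [← Finset.sum_div, div_mul_eq_mul_div, div_eq_mul_inv, mul_assoc]
  refine t.congr fun n => ?_
  rw [h1 n]
  congr 1
  · simp only [Finset.mul_sum]
  · refine tsum_congr fun m => ?_
    congr 3
    ring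

/-! ### The chain as a multisum. -/

/-- The summand of the Bailey chain of length `k`, as a function of the summation variables. -/
def chainTerm (q : ℂ) (c : ℕ → ℤ) : (k : ℕ) → ℕ → (Fin k → ℕ) → ℂ
  | 0, n, _ => (qPoch (q ^ 2) (q ^ 2) n)⁻¹
  | d + 1, N, s => invPoch q ((N : ℤ) - s 0) * q ^ ((s 0 : ℤ) ^ 2 + c d * s 0) *
      chainTerm q c d (s 0) (Fin.tail s)

/-- Reciprocals at negative indices vanish; hence summing over all tuples is summing over chains,
and the support is finite. -/
theorem antitone_of_chainTerm_ne_zero (q : ℂ) (c : ℕ → ℤ) (k N : ℕ) (s : Fin k → ℕ)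
    (h : chainTerm q c k N s ≠ 0) : Antitone s ∧ ∀ i, s i ≤ N := by
  induction k generalizing N with
  | zero => exact ⟨fun i => i.elim0, fun i => i.elim0⟩
  | succ k ih =>
    rw [chainTerm] at h
    obtain ⟨h1, h2⟩ := ih _ _ (right_ne_zero_of_mul h)
    have h3 : s 0 ≤ N := by
      by_contra hN
      exact left_ne_zero_of_mul (left_ne_zero_of_mul h) (invPoch_of_neg q (by omega))
    refine ⟨fun a b hab => ?_, Fin.cases h3 fun i => (h2 i).trans h3⟩
    induction a using Fin.cases with
    | zero => exact b.cases le_rfl h2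
    | succ a =>
      induction b using Fin.cases with
      | zero => exact absurd hab (by simp)
      | succ b => exact h1 (Fin.succ_le_succ_iff.mp hab)

theorem hasSum_chainTerm (q : ℂ) (c : ℕ → ℤ) (k N : ℕ) :
    HasSum (chainTerm q c k N) (baileyChain q c k N) := by
  induction k generalizing N with
  | zero => exact hasSum_unique (chainTerm q c 0 N)
  | succ k ih =>
    have hs : Summable (chainTerm q c (k + 1) N) := by
      refine summable_of_ne_finset_zero
        (s := Fintype.piFinset fun _ => Finset.range (N + 1)) fun s hs => ?_
      by_contra h
      refine hs (Fintype.mem_piFinset.mpr fun i => ?_)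
      exact Finset.mem_range.mpr
        (Nat.lt_succ_of_le ((antitone_of_chainTerm_ne_zero q c _ N s h).2 i))
    have h1 := ((Fin.consEquiv fun _ : Fin (k + 1) => ℕ).hasSum_iff).mpr hs.hasSum
    have h2 := h1.prod_fiberwise fun n => by
      simpa [chainTerm, Fin.consEquiv] using
        (ih n).mul_left (invPoch q ((N : ℤ) - n) * q ^ ((n : ℤ) ^ 2 + c k * n))
    have h3 := h2.unique (hasSum_sum_of_ne_finset_zero (s := Finset.range (N + 1)) fun n hn => by
      rw [invPoch_of_neg q (by simp at hn; omega : (N : ℤ) - n < 0), zero_mul, zero_mul])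
    rw [baileyChain, baileyStep, ← h3]
    exact hs.hasSum

/-- Nonnegative exponents stand in for `q ≠ 0`, so rewriting the summand also covers `q = 0`. -/
theorem zpow_add_of_nonneg (q : ℂ) {a b : ℤ} (ha : 0 ≤ a) (hb : 0 ≤ b) :
    q ^ (a + b) = q ^ a * q ^ b := by
  obtain ⟨x, rfl⟩ := Int.eq_ofNat_of_zero_le ha
  obtain ⟨y, rfl⟩ := Int.eq_ofNat_of_zero_le hb
  exact_mod_cast pow_add q x y

theorem prod_zpow_of_nonneg {ι : Type*} (q : ℂ) (t : Finset ι) (e : ι → ℤ) (he : ∀ i, 0 ≤ e i) :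
    ∏ i ∈ t, q ^ e i = q ^ ∑ i ∈ t, e i := by
  classical
  induction t using Finset.induction_on with
  | empty => simp
  | insert i t hi ih =>
    rw [Finset.prod_insert hi, Finset.sum_insert hi, ih,
      zpow_add_of_nonneg q (he i) (Finset.sum_nonneg fun i _ => he i)]

theorem sq_add_mul_nonneg (n : ℕ) {c : ℤ} (hc : -1 ≤ c) : 0 ≤ (n : ℤ) ^ 2 + c * n := by
  have : (n : ℤ) ≤ (n : ℤ) ^ 2 := Int.le_self_sq n
  nlinarith

theorem chainTerm_eq_prod (q : ℂ) (c : ℕ → ℤ) (k : ℕ) (p : ℕ → ℕ) :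
    chainTerm q c k (p 0) (fun i => p (i + 1))
      = (∏ i ∈ Finset.range k, invPoch q ((p i : ℤ) - p (i + 1))) *
        (∏ i ∈ Finset.range k, q ^ ((p (i + 1) : ℤ) ^ 2 + c (k - 1 - i) * p (i + 1))) *
        (qPoch (q ^ 2) (q ^ 2) (p k))⁻¹ := by
  induction k generalizing p with
  | zero => simp [chainTerm]
  | succ k ih =>
    have h := ih fun i => p (i + 1)
    have ht : Fin.tail (fun i : Fin (k + 1) => p (i + 1)) = fun i : Fin k => p (i + 1 + 1) := by
      ext i
      simp [Fin.tail]
    rw [chainTerm, ht, Fin.val_zero, h, Finset.prod_range_succ', Finset.prod_range_succ']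
    have e (i : ℕ) : k + 1 - 1 - (i + 1) = k - 1 - i := by omega
    simp only [e, zero_add]
    rw [show k + 1 - 1 - 0 = k by omega]
    ring

theorem neg_one_le_weight (k j r d : ℕ) : -1 ≤ weight k j r d := by
  unfold weight
  split_ifs <;> norm_num

theorem sum_Icc_one_eq (k : ℕ) (f : ℕ → ℤ) :
    ∑ i ∈ Finset.Icc 1 k, f i = ∑ i ∈ Finset.range k, f (i + 1) := by
  rw [Finset.range_eq_Ico, Finset.sum_Ico_add' f 0 k 1]
  rfl

/-- The variable `s_{i+1}` is used at stage `k - 1 - i`: the last `r` variables get weight 1, the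
first `j` weight -1, without overlap as `j + r ≤ k`. -/
theorem Chain.exponent_eq {k : ℕ} (s : Chain k) {j r : ℕ} (hjr : j + r ≤ k) :
    s.exponent j r = ∑ i ∈ Finset.range k,
      ((s.part (i + 1) : ℤ) ^ 2 + weight k j r (k - 1 - i) * s.part (i + 1)) := by
  have h1 : ∑ i ∈ Finset.Icc 1 j, (s.part i : ℤ)
      = ∑ i ∈ Finset.Icc 1 k, if i ≤ j then (s.part i : ℤ) else 0 := by
    rw [← Finset.sum_filter]
    congr 1
    ext i
    simp only [Finset.mem_Icc, Finset.mem_filter]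
    omega
  have h2 : ∑ i ∈ Finset.Icc (k - r + 1) k, (s.part i : ℤ)
      = ∑ i ∈ Finset.Icc 1 k, if k - r + 1 ≤ i then (s.part i : ℤ) else 0 := by
    rw [← Finset.sum_filter]
    congr 1
    ext i
    simp only [Finset.mem_Icc, Finset.mem_filter]
    omega
  rw [Chain.exponent, h1, h2, sum_Icc_one_eq, sum_Icc_one_eq, sum_Icc_one_eq,
    ← Finset.sum_sub_distrib, ← Finset.sum_add_distrib]
  refine Finset.sum_congr rfl fun i hi => ?_
  have hi := Finset.mem_range.mp hi
  rw [weight]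
  split_ifs <;> omega

theorem Chain.part_succ_le {k : ℕ} (s : Chain k) {i : ℕ} (hi : 1 ≤ i) (hik : i < k) :
    s.part (i + 1) ≤ s.part i := by
  rw [Chain.part, Chain.part, dif_pos (by omega), dif_pos (by omega)]
  exact s.2 (Fin.mk_le_mk.mpr (by omega))

theorem Chain.part_add_one {k : ℕ} (s : Chain k) (i : Fin k) : s.part (i + 1) = s.1 i := by
  rw [Chain.part, dif_pos (by omega)]
  rfl

theorem Chain.chainTerm_eq {k j r : ℕ} (s : Chain k) (hk : 1 ≤ k) (hjr : j + r ≤ k) (q : ℂ)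
    (N : ℕ) :
    chainTerm q (weight k j r) k N s.1
      = invPoch q ((N : ℤ) - s.part 1) * (q ^ s.exponent j r / s.denom q) := by
  obtain ⟨n, rfl⟩ := Nat.exists_eq_add_of_le' hk
  -- `N` is prepended as entry zero.
  have h := chainTerm_eq_prod q (weight (n + 1) j r) (n + 1)
    fun i => if i = 0 then N else s.part i
  simp only [if_true, Nat.add_eq_zero_iff, one_ne_zero, and_false, if_false, s.part_add_one] at h
  rw [h, prod_zpow_of_nonneg q _ _ fun i => sq_add_mul_nonneg _ (neg_one_le_weight _ _ _ _),
    ← s.exponent_eq hjr, Finset.prod_range_succ', Chain.denom]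
  simp only [if_true, Nat.add_eq_zero_iff, one_ne_zero, and_false, if_false, zero_add]
  have h2 : ∏ i ∈ Finset.Icc 1 (n + 1 - 1), qPoch q q (s.part i - s.part (i + 1))
      = (∏ i ∈ Finset.range n, invPoch q ((s.part (i + 1) : ℤ) - s.part (i + 1 + 1)))⁻¹ := by
    rw [← Finset.prod_inv_distrib, Nat.add_sub_cancel, Finset.range_eq_Ico,
      Finset.prod_Ico_add' (fun i => (invPoch q ((s.part i : ℤ) - s.part (i + 1)))⁻¹) 0 n 1]
    refine Finset.prod_congr rfl fun i hi => ?_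
    have hi := Finset.mem_Icc.mp hi
    rw [← Nat.cast_sub (s.part_succ_le hi.1 (by omega)), invPoch_natCast, inv_inv]
  rw [h2]
  field_simp

/-! ### Absolute convergence and the limit. -/

theorem summable_prod_pi {f : ℕ → ℝ} (hf0 : ∀ n, 0 ≤ f n) (hf : Summable f) (k : ℕ) :
    Summable fun s : Fin k → ℕ => ∏ i, f (s i) := by
  induction k with
  | zero => exact (hasSum_unique _).summable
  | succ k ih =>
    rw [← (Fin.consEquiv fun _ : Fin (k + 1) => ℕ).summable_iff]
    have := hf.mul_of_nonneg ih hf0 fun s => Finset.prod_nonneg fun i _ => hf0 _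
    refine this.congr fun x => ?_
    simp [Fin.consEquiv, Fin.prod_univ_succ]

/-- Weights at least -1 give `s² + cs ≥ s² - s`; the bound is uniform in `N`. -/
theorem exists_norm_chainTerm_le {q : ℂ} (hq : ‖q‖ < 1) (c : ℕ → ℤ) (hc : ∀ d, -1 ≤ c d) (k : ℕ) :
    ∃ C, ∀ N s, ‖chainTerm q c k N s‖ ≤ C * ∏ i, ‖q‖ ^ (s i ^ 2 - s i) := by
  obtain ⟨C, hC⟩ := exists_norm_invPoch_le hq
  induction k with
  | zero =>
    obtain ⟨D, hD⟩ := exists_norm_invPoch_le (q := q ^ 2)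
      (by rw [norm_pow]; exact pow_lt_one₀ (norm_nonneg q) hq two_ne_zero)
    refine ⟨D, fun N s => ?_⟩
    have := hD N
    rw [invPoch_natCast] at this
    simpa [chainTerm] using this
  | succ k ih =>
    obtain ⟨D, hD⟩ := ih
    refine ⟨C * D, fun N s => ?_⟩
    rw [chainTerm, norm_mul, norm_mul, Fin.prod_univ_succ]
    have h1 : ‖q ^ ((s 0 : ℤ) ^ 2 + c k * s 0)‖ ≤ ‖q‖ ^ (s 0 ^ 2 - s 0) := by
      have hs : s 0 ≤ s 0 ^ 2 := Nat.le_self_pow two_ne_zero _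
      have := norm_zpow_le_of_le hq (a := ((s 0 ^ 2 - s 0 : ℕ) : ℤ))
        (b := (s 0 : ℤ) ^ 2 + c k * s 0) (by positivity) (by
          push_cast [hs]
          nlinarith [hc k])
      rwa [zpow_natCast] at this
    have h2 := hD (s 0) (Fin.tail s)
    calc _ ≤ C * ‖q‖ ^ (s 0 ^ 2 - s 0) * (D * ∏ i, ‖q‖ ^ (Fin.tail s i ^ 2 - Fin.tail s i)) := by
          gcongr
          · exact mul_nonneg ((norm_nonneg _).trans (hC 0)) (by positivity)
          · exact (norm_nonneg _).trans (hC 0)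
          · exact hC _
      _ = _ := by
          simp only [Fin.tail]
          ring

theorem summable_pow_sq_sub_self {x : ℝ} (hx0 : 0 ≤ x) (hx : x < 1) :
    Summable fun n : ℕ => x ^ (n ^ 2 - n) := by
  rw [← summable_nat_add_iff 1]
  refine (summable_geometric_of_lt_one hx0 hx).of_nonneg_of_le (fun n => by positivity) fun n => ?_
  refine pow_le_pow_of_le_one hx0 hx.le (Nat.le_sub_of_add_le ?_)
  nlinarith

theorem Chain.summable_norm {k j r : ℕ} (hk : 1 ≤ k) (hjr : j + r ≤ k) {q : ℂ} (hq : ‖q‖ < 1) :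
    Summable fun s : Chain k => ‖q ^ s.exponent j r / s.denom q‖ := by
  obtain ⟨C, hC⟩ := exists_norm_chainTerm_le hq (weight k j r) (neg_one_le_weight k j r) k
  have h := ((summable_prod_pi (fun n => by positivity)
    (summable_pow_sq_sub_self (norm_nonneg q) hq) k).mul_left C).comp_injective
    (Subtype.val_injective (p := fun s : Fin k → ℕ => Antitone s))
  refine Summable.of_nonneg_of_le (fun _ => norm_nonneg _) (fun s => ?_) h
  -- Taking `N = s₁` makes the extra factor `1/(q)_0 = 1`.
  have h1 := hC (s.part 1) s.1
  rwa [s.chainTerm_eq hk hjr, sub_self, invPoch_zero, one_mul] at h1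

theorem Chain.hasSum_of_tendsto {k j r : ℕ} (hk : 1 ≤ k) (hjr : j + r ≤ k) {q : ℂ} (hq : ‖q‖ < 1)
    {R : ℂ} (hR : Tendsto (baileyChain q (weight k j r) k) atTop (𝓝 (R * (qPochInf q q)⁻¹))) :
    HasSum (fun s : Chain k => q ^ s.exponent j r / s.denom q) R := by
  have hs := Chain.summable_norm hk hjr hq
  obtain ⟨C, hC⟩ := exists_norm_invPoch_le hq
  have h1 (N : ℕ) : HasSum (fun s : Chain k => invPoch q ((N : ℤ) - s.part 1) *
      (q ^ s.exponent j r / s.denom q)) (baileyChain q (weight k j r) k N) := by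
    have h := (Function.Injective.hasSum_iff
      (Subtype.val_injective (p := fun s : Fin k → ℕ => Antitone s)) (fun s hs => by
        by_contra h
        exact hs ⟨⟨s, (antitone_of_chainTerm_ne_zero q _ _ _ _ h).1⟩, rfl⟩)).mpr
      (hasSum_chainTerm q (weight k j r) k N)
    simp only [← Chain.chainTerm_eq _ hk hjr q N]
    exact h
  have h2 : Tendsto (fun N : ℕ => ∑' s : Chain k, invPoch q ((N : ℤ) - s.part 1) *
      (q ^ s.exponent j r / s.denom q)) atTop
      (𝓝 (∑' s : Chain k, (qPochInf q q)⁻¹ * (q ^ s.exponent j r / s.denom q))) := by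
    refine tendsto_tsum_of_dominated_convergence (hs.mul_left C) (fun s => ?_)
      (Eventually.of_forall fun N s => ?_)
    · exact ((tendsto_invPoch hq).comp (tendsto_atTop_add_const_right atTop (-(s.part 1 : ℤ))
        tendsto_natCast_atTop_atTop)).mul_const _
    · rw [norm_mul]
      gcongr
      exact hC _
  simp only [fun N => (h1 N).tsum_eq, tsum_mul_left] at h2
  have h3 := tendsto_nhds_unique h2 hR
  rw [mul_comm] at h3
  rw [← mul_right_cancel₀ (inv_ne_zero (qPochInf_self_ne_zero hq)) h3]
  exact hs.of_norm.hasSum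

/-! ### The case `q = 0`. -/

theorem qPochInf_zero_zero : qPochInf 0 0 = 1 := by
  simp [qPochInf]

theorem invPoch_zero_of_nonneg {n : ℤ} (hn : 0 ≤ n) : invPoch 0 n = 1 := by
  simp [invPoch, not_lt.mpr hn, qPoch]

/-- Only `s = 0`, and `s = 1` at weight -1, give a nonzero power of 0. The truncated `d - (k - j)`
counts the weight -1 steps done so far. -/
theorem baileyChain_zero (k j r : ℕ) (hjr : j + r ≤ k) (d : ℕ) (n : ℕ) :
    baileyChain 0 (weight k j r) d n = 1 + if n = 0 then 0 else ((d - (k - j) : ℕ) : ℂ) := by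
  induction d generalizing n with
  | zero => simp [baileyChain, qPoch]
  | succ d ih =>
    have hz (s : ℕ) : (0 : ℂ) ^ (((s + 1 + 1 : ℕ) : ℤ) ^ 2 +
        weight k j r d * (s + 1 + 1 : ℕ)) = 0 := by
      refine zero_zpow _ (ne_of_gt ?_)
      have := neg_one_le_weight k j r d
      push_cast
      nlinarith
    rw [baileyChain, baileyStep]
    simp only [ih]
    rcases n with _ | n
    · simp [invPoch_zero]
    · rw [Finset.sum_range_succ', Finset.sum_range_succ']
      simp only [hz, mul_zero, zero_mul, Finset.sum_const_zero, zero_add]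
      rw [invPoch_zero_of_nonneg (by push_cast; omega), invPoch_zero_of_nonneg (by push_cast; omega)]
      rcases lt_or_ge d (k - j) with h | h
      · have hw : 0 ≤ weight k j r d := by
          unfold weight
          split_ifs <;> omega
        rw [Nat.sub_eq_zero_of_le h]
        simp [zero_zpow (1 + weight k j r d) (by omega)]
      · rw [weight, if_neg (by omega), if_pos h, Nat.succ_sub h]
        simp
        ring

end

theorem mainTheorem4 (k j r : ℕ) (hk : 1 ≤ k) (hjr : j + r ≤ k) (q : ℂ) (hq : ‖q‖ < 1) :
    HasSum (fun s : Chain k => q ^ s.exponent j r / s.denom q)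
      (∑ s ∈ Finset.range (j + 1),
        qPochInf₃ (q ^ ((k : ℤ) + 1 - r + j - 2 * s)) (q ^ ((k : ℤ) + 1 + r - j + 2 * s))
            (q ^ (2 * k + 2)) (q ^ (2 * k + 2))
          / qPochInf q q) := by
  refine Chain.hasSum_of_tendsto hk hjr hq ?_
  by_cases hq0 : q = 0
  · subst hq0
    -- All exponents are positive because `j + r ≤ k`, so the right side is `j + 1`.
    have hterm : ∀ s ∈ Finset.range (j + 1),
        qPochInf₃ ((0 : ℂ) ^ ((k : ℤ) + 1 - r + j - 2 * s)) (0 ^ ((k : ℤ) + 1 + r - j + 2 * s))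
          (0 ^ (2 * k + 2)) (0 ^ (2 * k + 2)) / qPochInf 0 0 = 1 := fun s hs => by
      have := Finset.mem_range.mp hs
      rw [zero_zpow _ (by omega), zero_zpow _ (by omega), zero_pow (by omega), qPochInf₃,
        qPochInf_zero_zero]
      norm_num
    rw [Finset.sum_congr rfl hterm]
    refine tendsto_const_nhds.congr' ((Filter.eventually_ge_atTop 1).mono fun n hn => ?_)
    rw [baileyChain_zero k j r hjr, if_neg (by omega), qPochInf_zero_zero,
      Nat.sub_sub_self (by omega)]
    simp
    ring
  · exact tendsto_baileyChain hq hq0 k j r hjr
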